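/- Let $\mathcal T=(V,E,F)$ be a triangulation, as a simplicial complex, of a surface without boundary (compact or not, of any topological type), with every vertex of finite degree. Write $\deg(i)$ for the number of edges at the vertex $i$. A circle-packing metric is a function $r:V\to(0,\infty)$. Given an intersection angle $\Phi:E\to[0,\tfrac{\pi}{2}]$, a circle-packing metric $r$ assigns to each edge $\{i,j\}$ the hyperbolic length $$l_{ij}=\cosh^{-1}\!\big(\cosh r_i\cosh r_j+\cos\Phi_{ij}\,\sinh r_i\sinh r_j\big),$$ and its discrete Gaussian curvature (in hyperbolic background geometry) at the vertex $i$ is $$K_i=2\pi-\sum_{\{i,j,k\}\in F}\theta_i^{jk},$$ where $\theta_i^{jk}$ is the inner angle at $i$ of the hyperbolic triangle with side lengths $l_{ij},l_{ik},l_{jk}$. Assume that $\sup_{i\in V}\deg(i)<\infty$ and $\Phi\equiv 0$, and let $\varepsilon>0$. Then for every $\hat K:V\to\mathbb R$ with $$\Big(2-\frac{\deg(i)}{3}\Big)\pi+\varepsilon<\hat K_i<2\pi\qquad\text{for all } i\in V,$$ there is a circle-packing metric $r:V\to(0,\infty)$ whose hyperbolic discrete Gaussian curvature satisfies $K_i=\hat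 K_i$ for all $i\in V$. -/

import Mathlib

/-- A triangulation `(V, E, F)` of a surface (without boundary), as a simplicial complex: `E` is the
edge set of a simple graph on `V`, each face is a set of three pairwise adjacent vertices, and around
every vertex the faces close up to a cycle, i.e. the link of every vertex is a cycle graph through
all its neighbours. The surface may be compact or not, and need not be orientable, simply connected
or connected. Local finiteness is implied, since the links are finite. -/
structure SurfaceTriangulation (V : Type*) where
  /-- the 1-skeleton `(V, E)` -/
  graph : SimpleGraph V
  /-- the set `F` of faces, each given by its set of vertices -/
  faces : Set (Set V)
  face_card : ∀ f ∈ faces, f.ncard = 3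
  face_adj : ∀ f ∈ faces, ∀ i ∈ f, ∀ j ∈ f, i ≠ j → graph.Adj i j
  /-- the link of `i`, the graph on the neighbours of `i` in which `j` and `k` are joined when
  `{i, j, k}` is a face, is a cycle -/
  link_cycle : ∀ i : V, ∃ n : ℕ, 3 ≤ n ∧ Nonempty
    (SimpleGraph.fromRel (fun j k : graph.neighborSet i => ({i, (j : V), (k : V)} : Set V) ∈ faces)
      ≃g SimpleGraph.cycleGraph n)

namespace SurfaceTriangulation

variable {V : Type*}

theorem finite_neighborSet (T : SurfaceTriangulation V) (i : V) :
    Finite (T.graph.neighborSet i) := by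
  obtain ⟨n, -, ⟨e⟩⟩ := T.link_cycle i
  exact Finite.of_equiv _ e.toEquiv.symm

noncomputable instance (T : SurfaceTriangulation V) : T.graph.LocallyFinite := fun i =>
  haveI := T.finite_neighborSet i
  Fintype.ofFinite _

/-- The combinatorial degrees are uniformly bounded. -/
def BoundedDegree (T : SurfaceTriangulation V) : Prop :=
  ∃ N : ℕ, ∀ i : V, T.graph.degree i ≤ N

/-- The pairs `{j, k}` such that `{i, j, k}` is a face: they index the faces at the vertex `i`. -/
def oppositeEdges (T : SurfaceTriangulation V) (i : V) : Set (Sym2 V) :=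
  {e | ∃ j k : V, e = s(j, k) ∧ ({i, j, k} : Set V) ∈ T.faces}

theorem ne_of_face (T : SurfaceTriangulation V) {i j k : V} (h : ({i, j, k} : Set V) ∈ T.faces) :
    i ≠ j ∧ i ≠ k ∧ j ≠ k := by
  have h3 := T.face_card _ h
  have two : ∀ a b : V, ({a, b} : Set V).ncard ≤ 2 := fun a b =>
    (Set.ncard_insert_le a {b}).trans (by simp)
  refine ⟨?_, ?_, ?_⟩
  · rintro rfl
    rw [Set.insert_eq_of_mem (by simp)] at h3
    have := two i k
    omega
  · rintro rfl
    rw [Set.insert_eq_of_mem (by simp)] at h3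
    have := two j i
    omega
  · rintro rfl
    rw [Set.insert_eq_of_mem (a := j) (by simp)] at h3
    have := two i j
    omega

/-- Only finitely many faces meet at a vertex, so the sum of the angles there is a finite sum. -/
theorem finite_oppositeEdges (T : SurfaceTriangulation V) (i : V) : (T.oppositeEdges i).Finite := by
  have hf : (T.graph.neighborSet i).Finite := T.finite_neighborSet i
  refine ((hf.prod hf).image (fun p : V × V => s(p.1, p.2))).subset ?_
  rintro e ⟨j, k, rfl, h⟩
  obtain ⟨hij, hik, -⟩ := T.ne_of_face h
  exact ⟨(j, k), ⟨T.face_adj _ h i (by simp) j (by simp) hij,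
    T.face_adj _ h i (by simp) k (by simp) hik⟩, rfl⟩

end SurfaceTriangulation

/-- The length of an edge `e = {i, j}` for the radii `r` and the intersection angle `Φ e`, in
hyperbolic background geometry. -/
noncomputable def hypEdgeLength {V : Type*} (Φ : Sym2 V → ℝ) (r : V → ℝ) (i j : V) : ℝ :=
  Real.arcosh (Real.cosh (r i) * Real.cosh (r j)
    + Real.cos (Φ s(i, j)) * Real.sinh (r i) * Real.sinh (r j))

/-- The inner angle of a hyperbolic triangle between two sides of lengths `a` and `b`, where the third
side has length `c` (hyperbolic law of cosines). -/
noncomputable def hypTriangleAngle (a b c : ℝ) : ℝ :=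
  Real.arccos ((Real.cosh a * Real.cosh b - Real.cosh c) / (Real.sinh a * Real.sinh b))

theorem hypEdgeLength_comm {V : Type*} (Φ : Sym2 V → ℝ) (r : V → ℝ) (i j : V) :
    hypEdgeLength Φ r i j = hypEdgeLength Φ r j i := by
  unfold hypEdgeLength
  rw [Sym2.eq_swap]
  congr 1
  ring

theorem hypTriangleAngle_comm (a b c : ℝ) : hypTriangleAngle a b c = hypTriangleAngle b a c := by
  unfold hypTriangleAngle
  rw [mul_comm (Real.cosh a), mul_comm (Real.sinh a)]

/-- The inner angle at `i` of the face `{i, j, k}`, as a function of the pair `{j, k}`. -/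
noncomputable def hypInnerAngle {V : Type*} (Φ : Sym2 V → ℝ) (r : V → ℝ) (i : V) : Sym2 V → ℝ :=
  Sym2.lift ⟨fun j k => hypTriangleAngle (hypEdgeLength Φ r i j) (hypEdgeLength Φ r i k)
    (hypEdgeLength Φ r j k), fun j k => by
      dsimp only
      rw [hypTriangleAngle_comm, hypEdgeLength_comm Φ r j k]⟩

/-- A circle-packing metric: a positive radius at every vertex. -/
def IsCirclePackingMetric {V : Type*} (r : V → ℝ) : Prop :=
  ∀ i : V, 0 < r i

/-- The discrete Gaussian curvature at the vertex `i`, in hyperbolic background geometry: `2π` minus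
the sum of the inner angles at `i` of the faces at `i`. Only the values of the intersection angle `Φ`
on the edges of the triangulation matter. -/
noncomputable def SurfaceTriangulation.hypCurvature {V : Type*} (T : SurfaceTriangulation V)
    (Φ : Sym2 V → ℝ) (r : V → ℝ) (i : V) : ℝ :=
  2 * Real.pi - ∑ᶠ e ∈ T.oppositeEdges i, hypInnerAngle Φ r i e

/-!
For `Φ = 0` the edge lengths are `r i + r j`, and the angle at a vertex of a face increases with the
radii at the two other vertices and tends to `0`, uniformly in them, when the radius at the vertex
itself tends to infinity. Perron's method applies: if the curvature of some metric `s` is at most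
`Khat`, then the supremum of the metrics `r ≥ s` with curvature at most `Khat` has curvature `Khat`;
it is finite because `Khat < 2π`. For `s` take a constant `ρ`, as the angles of an equilateral
triangle of side `2ρ` tend to `π / 3` when `ρ` tends to `0`.
-/

open Filter Function Real Topology

section Perron

/-- The family of subsolutions in Perron's method for the system `F i r = A i` in the unknown
`r : ι → α`: the `r` above the barrier `s` such that `F i r ≤ A i` for all `i`. Taking `≤` rather
than `≥` fits functions `F i` that decrease in the coordinates other than `i`, as curvatures do. -/
def perronFamily {ι α β : Type*} [LE α] [LE β] (F : ι → (ι → α) → β) (A : ι → β)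
    (s : ι → α) : Set (ι → α) :=
  {r | s ≤ r ∧ ∀ i, F i r ≤ A i}

variable {ι α β : Type*} [DecidableEq ι] [TopologicalSpace α]
  [LinearOrder β] [TopologicalSpace β] [OrderClosedTopology β]

section LinearOrder

variable [LinearOrder α] [OrderTopology α] {F : ι → (ι → α) → β} {A : ι → β} {s R : ι → α}

theorem mem_perronFamily_of_isLUB
    (hanti : ∀ i r r', s ≤ r → r ≤ r' → r i = r' i → F i r' ≤ F i r)
    (hcont : ∀ i r, s ≤ r → ContinuousAt (fun t => F i (update r i t)) (r i))
    (hne : (perronFamily F A s).Nonempty) (hR : IsLUB (perronFamily F A s) R) :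
    R ∈ perronFamily F A s := by
  have hsR : s ≤ R := let ⟨_, hr⟩ := hne; hr.1.trans (hR.1 hr)
  refine ⟨hsR, fun i => le_of_not_gt fun hlt => ?_⟩
  have hnear : ∀ᶠ t in 𝓝 (R i), A i < F i (update R i t) :=
    (hcont i R hsR).eventually_const_lt (by simpa only [update_eq_self])
  obtain ⟨_, ⟨r, hr, rfl⟩, hri⟩ :=
    (((isLUB_pi.1 hR i).frequently_nhds_mem (hne.image _)).and_eventually hnear).exists
  have hle : r ≤ update R i (r i) := le_update_iff.2 ⟨le_rfl, fun j _ => hR.1 hr j⟩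
  exact (hri.trans_le (hanti i r _ hr.1 hle (update_self i (r i) R).symm)).not_ge (hr.2 i)

variable [DenselyOrdered α] [NoMaxOrder α]

theorem eq_of_isLUB_perronFamily
    (hanti : ∀ i r r', s ≤ r → r ≤ r' → r i = r' i → F i r' ≤ F i r)
    (hcont : ∀ i r, s ≤ r → ContinuousAt (fun t => F i (update r i t)) (r i))
    (hne : (perronFamily F A s).Nonempty) (hR : IsLUB (perronFamily F A s) R) (i : ι) :
    F i R = A i := by
  obtain ⟨hsR, hRA⟩ := mem_perronFamily_of_isLUB hanti hcont hne hR
  refine (hRA i).eq_of_not_lt fun hlt => ?_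
  have hnear : ∀ᶠ t in 𝓝 (R i), F i (update R i t) < A i :=
    (hcont i R hsR).eventually_lt_const (by simpa only [update_eq_self])
  obtain ⟨t, hRt, ht⟩ := ((frequently_gt_nhds (R i)).and_eventually hnear).exists
  have hle : R ≤ update R i t := le_update_self_iff.2 hRt.le
  have hmem : update R i t ∈ perronFamily F A s := by
    refine ⟨hsR.trans hle, fun j => ?_⟩
    obtain rfl | hj := eq_or_ne j i
    · exact ht.le
    · exact (hanti j R _ hsR hle (update_of_ne hj ..).symm).trans (hRA j)
  exact hRt.not_ge (update_le_self_iff.1 (hR.1 hmem))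

end LinearOrder

theorem exists_eq_of_bddAbove_perronFamily [ConditionallyCompleteLinearOrder α] [OrderTopology α]
    [DenselyOrdered α] [NoMaxOrder α] {F : ι → (ι → α) → β} {A : ι → β} {s : ι → α}
    (hanti : ∀ i r r', s ≤ r → r ≤ r' → r i = r' i → F i r' ≤ F i r)
    (hcont : ∀ i r, s ≤ r → ContinuousAt (fun t => F i (update r i t)) (r i))
    (hs : ∀ i, F i s ≤ A i) (hbdd : BddAbove (perronFamily F A s)) :
    ∃ r, s ≤ r ∧ ∀ i, F i r = A i := by
  have hmem : s ∈ perronFamily F A s := ⟨le_rfl, hs⟩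
  have hR := isLUB_csSup ⟨s, hmem⟩ hbdd
  exact ⟨_, hR.1 hmem, eq_of_isLUB_perronFamily hanti hcont ⟨s, hmem⟩ hR⟩

end Perron

section TangentCircles

variable {x y y' z z' : ℝ}

theorem sinh_div_sinh_add_nonneg (hx : 0 ≤ x) (hy : 0 ≤ y) : 0 ≤ sinh y / sinh (x + y) :=
  div_nonneg (sinh_nonneg_iff.2 hy) (sinh_nonneg_iff.2 (add_nonneg hx hy))

theorem sinh_div_sinh_add_le_of_le (hx : 0 ≤ x) (hy : 0 < y) (hyy' : y ≤ y') :
    sinh y / sinh (x + y) ≤ sinh y' / sinh (x + y') := by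
  have hxy : 0 < sinh (x + y) := sinh_pos_iff.2 (by positivity)
  have hxy' : 0 < sinh (x + y') := sinh_pos_iff.2 (by linarith)
  rw [div_le_div_iff₀ hxy hxy', ← sub_nonneg]
  have hdiff : sinh y' * sinh (x + y) - sinh y * sinh (x + y') = sinh x * sinh (y' - y) := by
    rw [sinh_add, sinh_add, sinh_sub]
    ring
  rw [hdiff]
  exact mul_nonneg (sinh_nonneg_iff.2 hx) (sinh_nonneg_iff.2 (sub_nonneg.2 hyy'))

theorem sinh_div_sinh_add_le_exp_neg (hx : 0 ≤ x) (hy : 0 < y) :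
    sinh y / sinh (x + y) ≤ exp (-x) := by
  have hxy : 0 < sinh (x + y) := sinh_pos_iff.2 (by positivity)
  have hdiff : exp (-x) * sinh (x + y) - sinh y = exp (-x) * (sinh x * exp (-y)) := by
    have hexp : exp (-x) * exp x = 1 := by rw [← exp_add, neg_add_cancel, exp_zero]
    rw [← cosh_sub_sinh y, sinh_add]
    rw [← cosh_add_sinh x] at hexp
    linear_combination sinh y * hexp
  rw [div_le_iff₀ hxy, ← sub_nonneg, hdiff]
  exact mul_nonneg (exp_pos _).le (mul_nonneg (sinh_nonneg_iff.2 hx) (exp_pos _).le)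

/-- The angle at the centre of the circle of radius `x` in the hyperbolic triangle formed by the
centres of three mutually tangent circles of radii `x`, `y`, `z`. The formula is the half-angle
formula for the triangle with sides `x + y`, `x + z`, `y + z`. -/
noncomputable def tangentAngle (x y z : ℝ) : ℝ :=
  arccos (1 - 2 * (sinh y / sinh (x + y)) * (sinh z / sinh (x + z)))

/-- The limit of `tangentAngle x y z` as `y` and `z` tend to infinity: the angle at the centre of a
circle of radius `x` in the triangle formed with two horocycles tangent to it and to each other. -/
noncomputable def horocycleAngle (x : ℝ) : ℝ :=
  arccos (1 - 2 * exp (-x) ^ 2)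

theorem hypTriangleAngle_add (hxy : x + y ≠ 0) (hxz : x + z ≠ 0) :
    hypTriangleAngle (x + y) (x + z) (y + z) = tangentAngle x y z := by
  have hsinh_xy : sinh (x + y) ≠ 0 := sinh_ne_zero.2 hxy
  have hsinh_xz : sinh (x + z) ≠ 0 := sinh_ne_zero.2 hxz
  have hcosh_sub : cosh (y - z) = cosh (x + y) * cosh (x + z) - sinh (x + y) * sinh (x + z) := by
    rw [← cosh_sub, add_sub_add_left_eq_sub]
  rw [cosh_sub] at hcosh_sub
  rw [hypTriangleAngle, tangentAngle, cosh_add y z]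
  congr 1
  field_simp
  linarith

theorem tangentAngle_le_tangentAngle (hx : 0 ≤ x) (hy : 0 < y) (hz : 0 < z)
    (hyy' : y ≤ y') (hzz' : z ≤ z') : tangentAngle x y z ≤ tangentAngle x y' z' := by
  refine antitone_arccos ?_
  have hprod := mul_le_mul (sinh_div_sinh_add_le_of_le hx hy hyy')
    (sinh_div_sinh_add_le_of_le hx hz hzz') (sinh_div_sinh_add_nonneg hx hz.le)
    (sinh_div_sinh_add_nonneg hx (hy.le.trans hyy'))
  linarith

theorem tangentAngle_le_horocycleAngle (hx : 0 ≤ x) (hy : 0 < y) (hz : 0 < z) :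
    tangentAngle x y z ≤ horocycleAngle x := by
  refine antitone_arccos ?_
  have hprod := mul_le_mul (sinh_div_sinh_add_le_exp_neg hx hy)
    (sinh_div_sinh_add_le_exp_neg hx hz) (sinh_div_sinh_add_nonneg hx hz.le)
    (exp_pos _).le
  linarith

theorem tendsto_horocycleAngle_atTop : Tendsto horocycleAngle atTop (𝓝 0) := by
  have harg : Tendsto (fun x => 1 - 2 * exp (-x) ^ 2) atTop (𝓝 1) := by
    simpa using ((tendsto_exp_neg_atTop_nhds_zero.pow 2).const_mul 2).const_sub 1
  exact arccos_one ▸ (continuous_arccos.tendsto 1).comp harg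

theorem continuousAt_tangentAngle {X : Type*} [TopologicalSpace X] {f g h : X → ℝ} {a : X}
    (hf : ContinuousAt f a) (hg : ContinuousAt g a) (hh : ContinuousAt h a)
    (hfg : f a + g a ≠ 0) (hfh : f a + h a ≠ 0) :
    ContinuousAt (fun p => tangentAngle (f p) (g p) (h p)) a := by
  have hsinh_fg : sinh (f a + g a) ≠ 0 := sinh_ne_zero.2 hfg
  have hsinh_fh : sinh (f a + h a) ≠ 0 := sinh_ne_zero.2 hfh
  unfold tangentAngle
  refine continuous_arccos.continuousAt.comp ?_
  fun_prop (disch := assumption)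

theorem tangentAngle_self (hx : x ≠ 0) :
    tangentAngle x x x = arccos (1 - 1 / (2 * cosh x ^ 2)) := by
  have hsinh : sinh x ≠ 0 := sinh_ne_zero.2 hx
  have hcosh : cosh x ≠ 0 := (cosh_pos x).ne'
  rw [tangentAngle, ← two_mul, sinh_two_mul]
  congr 1
  field_simp

theorem tendsto_tangentAngle_self :
    Tendsto (fun x => tangentAngle x x x) (𝓝[≠] 0) (𝓝 (π / 3)) := by
  have hcont : Continuous fun x : ℝ => arccos (1 - 1 / (2 * cosh x ^ 2)) := by
    have hne : ∀ x : ℝ, 2 * cosh x ^ 2 ≠ 0 := fun x =>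
      mul_ne_zero two_ne_zero (pow_ne_zero 2 (cosh_pos x).ne')
    exact continuous_arccos.comp (by fun_prop (disch := exact hne _))
  have hzero : arccos (1 - 1 / (2 * cosh 0 ^ 2)) = π / 3 := by
    rw [← arccos_cos (x := π / 3) (by positivity) (by linarith [pi_pos]), cos_pi_div_three,
      cosh_zero]
    norm_num
  refine ((hzero ▸ hcont.tendsto 0).mono_left nhdsWithin_le_nhds).congr' ?_
  filter_upwards [self_mem_nhdsWithin] with x hx using (tangentAngle_self hx).symm

end TangentCircles

theorem hypEdgeLength_of_eq_zero {V : Type*} {Φ : Sym2 V → ℝ} {r : V → ℝ} {i j : V}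
    (hΦ : Φ s(i, j) = 0) (hij : 0 ≤ r i + r j) : hypEdgeLength Φ r i j = r i + r j := by
  rw [hypEdgeLength, hΦ, cos_zero, one_mul, ← cosh_add, arcosh_cosh hij]

theorem card_edgeFinset_cycleGraph {n : ℕ} (hn : 3 ≤ n) :
    (SimpleGraph.cycleGraph n).edgeFinset.card = n := by
  obtain ⟨m, rfl⟩ := Nat.exists_eq_add_of_le' hn
  have hsum := (SimpleGraph.cycleGraph (m + 3)).sum_degrees_eq_twice_card_edges
  simp only [SimpleGraph.cycleGraph_degree_three_le, Finset.sum_const, Finset.card_univ,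
    Fintype.card_fin, smul_eq_mul] at hsum
  omega

namespace SurfaceTriangulation

variable {V : Type*} (T : SurfaceTriangulation V)

section Combinatorics

/-- The link of the vertex `i`: the graph on the neighbours of `i` that `link_cycle` asserts to be
a cycle. -/
def link (i : V) : SimpleGraph (T.graph.neighborSet i) :=
  SimpleGraph.fromRel fun j k : T.graph.neighborSet i => ({i, (j : V), (k : V)} : Set V) ∈ T.faces

variable {T} in
theorem adj_of_face {i j k : V} (h : ({i, j, k} : Set V) ∈ T.faces) :
    T.graph.Adj i j ∧ T.graph.Adj i k ∧ T.graph.Adj j k := by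
  obtain ⟨hij, hik, hjk⟩ := T.ne_of_face h
  exact ⟨T.face_adj _ h i (by simp) j (by simp) hij, T.face_adj _ h i (by simp) k (by simp) hik,
    T.face_adj _ h j (by simp) k (by simp) hjk⟩

theorem image_edgeSet_link (i : V) :
    Sym2.map Subtype.val '' (T.link i).edgeSet = T.oppositeEdges i := by
  ext e
  constructor
  · rintro ⟨e, he, rfl⟩
    induction e with
    | _ j k =>
      rcases he.2 with h | h
      · exact ⟨j, k, rfl, h⟩
      · exact ⟨k, j, Sym2.eq_swap, h⟩
  · rintro ⟨j, k, rfl, h⟩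
    obtain ⟨hij, hik, hjk⟩ := adj_of_face h
    exact ⟨s(⟨j, hij⟩, ⟨k, hik⟩), ⟨fun hjk' => hjk.ne (congrArg Subtype.val hjk'), .inl h⟩, rfl⟩

theorem ncard_oppositeEdges (i : V) : (T.oppositeEdges i).ncard = T.graph.degree i := by
  classical
  obtain ⟨n, hn, ⟨e⟩⟩ := T.link_cycle i
  change T.link i ≃g SimpleGraph.cycleGraph n at e
  rw [← image_edgeSet_link,
    Set.ncard_image_of_injective _ (Sym2.map.injective Subtype.val_injective),
    ← SimpleGraph.coe_edgeFinset, Set.ncard_coe_finset, e.card_edgeFinset_eq,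
    card_edgeFinset_cycleGraph hn, ← SimpleGraph.card_neighborSet_eq_degree,
    Fintype.card_congr e.toEquiv, Fintype.card_fin]

theorem card_toFinset_oppositeEdges (i : V) :
    (T.finite_oppositeEdges i).toFinset.card = T.graph.degree i := by
  rw [← ncard_oppositeEdges, Set.ncard_eq_toFinset_card _ (T.finite_oppositeEdges i)]

variable {T} in
theorem BoundedDegree.exists_degree_mul_le (hT : T.BoundedDegree) {ε : ℝ} (hε : 0 < ε) :
    ∃ δ > 0, ∀ i, T.graph.degree i * δ ≤ ε := by
  obtain ⟨N, hN⟩ := hT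
  refine ⟨ε / (N + 1), by positivity, fun i => ?_⟩
  have hdeg : (T.graph.degree i : ℝ) ≤ N + 1 := by exact_mod_cast (hN i).trans N.le_succ
  calc T.graph.degree i * (ε / (N + 1)) ≤ (N + 1) * (ε / (N + 1)) := by gcongr
    _ = ε := mul_div_cancel₀ ε (by positivity)

end Combinatorics

section Curvature

variable {T} {Φ : Sym2 V → ℝ} {r r' : V → ℝ} {i j k : V}

theorem hypCurvature_eq_sum : T.hypCurvature Φ r i =
    2 * π - ∑ e ∈ (T.finite_oppositeEdges i).toFinset, hypInnerAngle Φ r i e := by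
  rw [hypCurvature, finsum_mem_eq_finite_toFinset_sum]

variable (hΦ : ∀ e ∈ T.graph.edgeSet, Φ e = 0)
include hΦ

theorem hypInnerAngle_eq_tangentAngle (hi : 0 < r i) (hj : 0 < r j) (hk : 0 < r k)
    (h : ({i, j, k} : Set V) ∈ T.faces) :
    hypInnerAngle Φ r i s(j, k) = tangentAngle (r i) (r j) (r k) := by
  obtain ⟨hij, hik, hjk⟩ := adj_of_face h
  change hypTriangleAngle (hypEdgeLength Φ r i j) (hypEdgeLength Φ r i k)
    (hypEdgeLength Φ r j k) = _
  rw [hypEdgeLength_of_eq_zero (hΦ _ hij) (by positivity),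
    hypEdgeLength_of_eq_zero (hΦ _ hik) (by positivity),
    hypEdgeLength_of_eq_zero (hΦ _ hjk) (by positivity),
    hypTriangleAngle_add (by positivity) (by positivity)]

theorem hypCurvature_le_of_le_of_eq (hr : IsCirclePackingMetric r) (hle : r ≤ r')
    (hi : r i = r' i) : T.hypCurvature Φ r' i ≤ T.hypCurvature Φ r i := by
  rw [hypCurvature_eq_sum, hypCurvature_eq_sum]
  refine sub_le_sub_left (Finset.sum_le_sum fun e he => ?_) _
  obtain ⟨j, k, rfl, h⟩ := (T.finite_oppositeEdges i).mem_toFinset.1 he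
  have hr' : IsCirclePackingMetric r' := fun l => (hr l).trans_le (hle l)
  rw [hypInnerAngle_eq_tangentAngle hΦ (hr i) (hr j) (hr k) h,
    hypInnerAngle_eq_tangentAngle hΦ (hr' i) (hr' j) (hr' k) h, ← hi]
  exact tangentAngle_le_tangentAngle (hr i).le (hr j) (hr k) (hle j) (hle k)

theorem sub_degree_mul_horocycleAngle_le_hypCurvature (hr : IsCirclePackingMetric r) :
    2 * π - T.graph.degree i * horocycleAngle (r i) ≤ T.hypCurvature Φ r i := by
  rw [hypCurvature_eq_sum, ← T.card_toFinset_oppositeEdges i, ← nsmul_eq_mul]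
  refine sub_le_sub_left (Finset.sum_le_card_nsmul _ _ _ fun e he => ?_) _
  obtain ⟨j, k, rfl, h⟩ := (T.finite_oppositeEdges i).mem_toFinset.1 he
  rw [hypInnerAngle_eq_tangentAngle hΦ (hr i) (hr j) (hr k) h]
  exact tangentAngle_le_horocycleAngle (hr i).le (hr j) (hr k)

theorem hypCurvature_const {ρ : ℝ} (hρ : 0 < ρ) :
    T.hypCurvature Φ (fun _ => ρ) i = 2 * π - T.graph.degree i * tangentAngle ρ ρ ρ := by
  rw [hypCurvature_eq_sum, ← T.card_toFinset_oppositeEdges i, ← nsmul_eq_mul]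
  congr 1
  refine Finset.sum_eq_card_nsmul fun e he => ?_
  obtain ⟨j, k, rfl, h⟩ := (T.finite_oppositeEdges i).mem_toFinset.1 he
  exact hypInnerAngle_eq_tangentAngle hΦ hρ hρ hρ h

theorem continuousAt_hypCurvature (hr : IsCirclePackingMetric r) :
    ContinuousAt (fun s => T.hypCurvature Φ s i) r := by
  simp only [hypCurvature_eq_sum]
  refine continuousAt_const.sub (tendsto_finsetSum _ fun e he => ?_)
  obtain ⟨j, k, rfl, h⟩ := (T.finite_oppositeEdges i).mem_toFinset.1 he
  have hpos (l : V) : ∀ᶠ s : V → ℝ in 𝓝 r, 0 < s l :=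
    (continuousAt_apply l r).eventually_const_lt (hr l)
  have hangle : ContinuousAt (fun s : V → ℝ => tangentAngle (s i) (s j) (s k)) r :=
    continuousAt_tangentAngle (continuousAt_apply i r) (continuousAt_apply j r)
      (continuousAt_apply k r) (add_pos (hr i) (hr j)).ne' (add_pos (hr i) (hr k)).ne'
  refine ContinuousAt.congr hangle ?_
  filter_upwards [hpos i, hpos j, hpos k] with s hi hj hk
    using (hypInnerAngle_eq_tangentAngle hΦ hi hj hk h).symm

theorem continuousAt_hypCurvature_update [DecidableEq V] (hr : IsCirclePackingMetric r) :
    ContinuousAt (fun t => T.hypCurvature Φ (update r i t) i) (r i) :=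
  (continuousAt_hypCurvature hΦ hr).comp_of_eq
    (continuous_const.update i continuous_id).continuousAt (update_eq_self i r)

theorem bddAbove_perronFamily_hypCurvature {s Khat : V → ℝ} (hs : IsCirclePackingMetric s)
    (hK : ∀ i, Khat i < 2 * π) :
    BddAbove (perronFamily (fun i r => T.hypCurvature Φ r i) Khat s) := by
  have hlarge (i : V) :
      ∃ M, ∀ x ≥ M, Khat i < 2 * π - T.graph.degree i * horocycleAngle x := by
    have hlim := (tendsto_horocycleAngle_atTop.const_mul (T.graph.degree i : ℝ)).const_sub (2 * π)
    rw [mul_zero, sub_zero] at hlim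
    exact eventually_atTop.1 (hlim.eventually_const_lt (hK i))
  choose M hM using hlarge
  refine ⟨M, fun r ⟨hsr, hr⟩ i => le_of_not_gt fun hlt => ?_⟩
  have hrpos : IsCirclePackingMetric r := fun l => (hs l).trans_le (hsr l)
  exact ((hM i _ hlt.le).trans_le
    (sub_degree_mul_horocycleAngle_le_hypCurvature hΦ hrpos)).not_ge (hr i)

theorem exists_hypCurvature_eq_of_hypCurvature_le {s Khat : V → ℝ} (hs : IsCirclePackingMetric s)
    (hsub : ∀ i, T.hypCurvature Φ s i ≤ Khat i) (hK : ∀ i, Khat i < 2 * π) :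
    ∃ r, s ≤ r ∧ ∀ i, T.hypCurvature Φ r i = Khat i := by
  classical
  have hpos {r : V → ℝ} (hsr : s ≤ r) : IsCirclePackingMetric r := fun l => (hs l).trans_le (hsr l)
  exact exists_eq_of_bddAbove_perronFamily
    (fun _ _ _ hsr hle hi => hypCurvature_le_of_le_of_eq hΦ (hpos hsr) hle hi)
    (fun _ _ hsr => continuousAt_hypCurvature_update hΦ (hpos hsr)) hsub
    (bddAbove_perronFamily_hypCurvature hΦ hs hK)

theorem exists_hypCurvature_const_le {δ : ℝ} (hδ : 0 < δ) : ∃ ρ > 0, ∀ i,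
    T.hypCurvature Φ (fun _ => ρ) i ≤
      (2 - T.graph.degree i / 3) * π + T.graph.degree i * δ := by
  have hnear : ∀ᶠ ρ in 𝓝[>] (0 : ℝ), π / 3 - δ < tangentAngle ρ ρ ρ :=
    (tendsto_tangentAngle_self.mono_left (nhdsGT_le_nhdsNE 0)).eventually_const_lt
      (sub_lt_self _ hδ)
  obtain ⟨ρ, hangle, hρ⟩ := (hnear.and self_mem_nhdsWithin).exists
  refine ⟨ρ, hρ, fun i => ?_⟩
  rw [hypCurvature_const hΦ hρ]
  linarith [mul_le_mul_of_nonneg_left hangle.le (T.graph.degree i).cast_nonneg]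

end Curvature

end SurfaceTriangulation

theorem corollary4p4_general {V : Type*} (T : SurfaceTriangulation V)
    (Φ : Sym2 V → ℝ) (hΦ : ∀ e ∈ T.graph.edgeSet, Φ e = 0)
    (δ : ℝ) (hδ : 0 < δ) (Khat : V → ℝ)
    (hK : ∀ i : V, (2 - (T.graph.degree i : ℝ) / 3) * π + T.graph.degree i * δ ≤ Khat i ∧
      Khat i < 2 * π) :
    ∃ r : V → ℝ, IsCirclePackingMetric r ∧ ∀ i : V, T.hypCurvature Φ r i = Khat i := by
  obtain ⟨ρ, hρ, hcurv⟩ := SurfaceTriangulation.exists_hypCurvature_const_le hΦ hδ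
  obtain ⟨r, hr, hrK⟩ := SurfaceTriangulation.exists_hypCurvature_eq_of_hypCurvature_le hΦ
    (fun _ => hρ) (fun i => (hcurv i).trans (hK i).1) (fun i => (hK i).2)
  exact ⟨r, fun i => hρ.trans_le (hr i), hrK⟩

theorem corollary4p4 {V : Type*} (T : SurfaceTriangulation V) (hT : T.BoundedDegree)
    (Φ : Sym2 V → ℝ) (hΦ : ∀ e ∈ T.graph.edgeSet, Φ e = 0)
    (ε : ℝ) (hε : 0 < ε) (Khat : V → ℝ)
    (hK : ∀ i : V, (2 - (T.graph.degree i : ℝ) / 3) * Real.pi + ε < Khat i ∧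
      Khat i < 2 * Real.pi) :
    ∃ r : V → ℝ, IsCirclePackingMetric r ∧ ∀ i : V, T.hypCurvature Φ r i = Khat i := by
  obtain ⟨δ, hδ, hdeg⟩ := hT.exists_degree_mul_le hε
  exact corollary4p4_general T Φ hΦ δ hδ Khat fun i => ⟨by linarith [hdeg i, hK i], (hK i).2⟩
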